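/- \textbf{Theorem (Pumping Lemma for polynomially-ambiguous automata).} Let $\Sigma$ be a finite alphabet. A weighted automaton over the min-plus semiring $(\mathbb{N}\cup\{+\infty\},\min,+,+\infty,0)$ consists of a finite set $Q$ of states, matrices $M_a\in(\mathbb{N}\cup\{+\infty\})^{Q\times Q}$ for $a\in\Sigma$, and vectors $I,F\in(\mathbb{N}\cup\{+\infty\})^{Q}$. An accepting run over $w=a_1\cdots a_\ell$ is a sequence of states $q_0,\dots,q_\ell$ such that $I(q_0)$, $F(q_\ell)$ and all $M_{a_i}(q_{i-1},q_i)$ are different from $+\infty$. The output over $w$ is $I^t M_{a_1}\cdots M_{a_\ell}F$, computed in the min-plus semiring. The automaton is polynomially ambiguous if the number of accepting runs over $w$ is bounded by a polynomial in the length $|w|$. For $n>0$, an $n$-pumping representation of a word $w\in\Sigma^*$ is a factorisation $w=u_0\,\underline{v_1}\,u_1\,\underline{v_2}\cdots u_{n-1}\,\underline{v_n}\,u_n$ with all $v_k\neq\epsilon$. A refinement of it is a factorisation $w=u_0'\,\underline{y_1}\,u_1'\cdots u_{n-1}'\,\underline{y_n}\,u_n'$ for which there are words $x_k,z_k$ such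 that $v_k=x_ky_kz_k$ and $y_k\neq\epsilon$ for $1\le k\le n$, and $u_k'=z_ku_kx_{k+1}$ for $0\le k\le n$, where $z_0=x_{n+1}=\epsilon$. Given a refinement, for $S\subseteq\{1,\dots,n\}$ and $i\in\mathbb{N}$ let $w(S,i)$ be the word obtained from $u_0'y_1u_1'\cdots y_nu_n'$ by replacing $y_k$ with $y_k^i$ for every $k\in S$. A partition of $\{1,\dots,n\}$ is a sequence $S_1,\dots,S_m$ of non-empty pairwise disjoint sets with union $\{1,\dots,n\}$, and a selection set for it is a set $S\subseteq\{1,\dots,n\}$ with $|S\cap S_j|=1$ for every $j$. Let $f:\Sigma^*\to\mathbb{N}\cup\{+\infty\}$ be the output function of a polynomially ambiguous weighted automaton over the min-plus semiring. Then there exist $N\in\mathbb{N}$ and a function $\varphi:\mathbb{N}\to\mathbb{N}$ such that for every $n>0$ and every $n$-pumping representation $w=u_0\,\underline{v_1}\,u_1\cdots u_{n-1}\,\underline{v_n}\,u_n$ with $|v_k|\ge N$ for all $k$ there exists a refinement such that, for every partition $S_1,\dots,S_m$ of $\{1,\dots,n\}$ with $m\ge\varphi(\max_j|S_j|)$, one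 of the following holds: \begin{itemize} \item there exists $j$ such that $f(w(S_j,i))=f(w(S_j,i+1))$ for all but finitely many $i$; \item there exists a selection set $S$ for $S_1,\dots,S_m$ such that $f(w(S,i))<f(w(S,i+1))$ for all but finitely many $i$. \end{itemize} -/

import Mathlib

open Filter Matrix

/-- The min-plus semiring `(ℕ ∪ {+∞}, min, +, +∞, 0)`: its zero is `trop ⊤`, its one is `trop 0`,
its sum is the minimum and its product is the sum of `ℕ∞`. -/
abbrev MinPlus : Type := Tropical ℕ∞

/-- A weighted automaton over the semiring `S`, the alphabet `α` and the set of states `Q`. -/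
structure WeightedAutomaton (S : Type*) (α : Type*) (Q : Type*) where
  /-- the transition matrices -/
  M : α → Matrix Q Q S
  /-- the initial vector -/
  I : Q → S
  /-- the final vector -/
  F : Q → S

namespace WeightedAutomaton

variable {S α Q : Type*} [CommSemiring S]

/-- `M_w = M_{a_1} ⋯ M_{a_n}` for the word `w = a_1 … a_n`. -/
def wordMatrix [Fintype Q] [DecidableEq Q] (A : WeightedAutomaton S α Q) (w : List α) :
    Matrix Q Q S :=
  (w.map A.M).prod

/-- The output `Iᵗ ⬝ M_w ⬝ F` of the automaton over the word `w`. -/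
def output [Fintype Q] [DecidableEq Q] (A : WeightedAutomaton S α Q) (w : List α) : S :=
  A.I ⬝ᵥ (A.wordMatrix w *ᵥ A.F)

/-- The set of accepting runs over `w = a_1 … a_n`. A transition between two states on a given
letter is determined by the two states (its weight is the entry of the transition matrix), so a run
is given by its sequence of states `q_0, …, q_n`. -/
def acceptingRuns (A : WeightedAutomaton S α Q) (w : List α) : Set (Fin (w.length + 1) → Q) :=
  {q | A.I (q 0) ≠ 0 ∧
    (∀ i : Fin w.length, A.M (w.get i) (q i.castSucc) (q i.succ) ≠ 0) ∧
    A.F (q (Fin.last w.length)) ≠ 0}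

/-- The number of accepting runs is bounded by a polynomial in the length of the word. -/
def PolynomiallyAmbiguous (A : WeightedAutomaton S α Q) : Prop :=
  ∃ p : Polynomial ℕ, ∀ w : List α, (A.acceptingRuns w).ncard ≤ p.eval w.length

end WeightedAutomaton

/-- `f` is definable by a polynomially-ambiguous weighted automaton over the min-plus semiring. -/
def PolyAmbiguouslyRecognisable {α : Type*} (f : List α → ℕ∞) : Prop :=
  ∃ (Q : Type) (_ : Fintype Q) (_ : DecidableEq Q) (A : WeightedAutomaton MinPlus α Q),
    A.PolynomiallyAmbiguous ∧ ∀ w : List α, f w = Tropical.untrop (A.output w)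

/-- The data of an `n`-pumping representation `u_0 v_1 u_1 v_2 … u_{n-1} v_n u_n`, with non-empty
pumping factors; the factor `v_{k+1}` is `v k` for `k : Fin n`. -/
structure PumpingRep (α : Type*) (n : ℕ) where
  u : Fin (n + 1) → List α
  v : Fin n → List α
  v_ne : ∀ k, v k ≠ []

namespace PumpingRep

variable {α : Type*} {n : ℕ}

/-- The word `u_0 t_1 u_1 t_2 … u_{n-1} t_n u_n`. -/
def interleave (u : Fin (n + 1) → List α) (t : Fin n → List α) : List α :=
  u 0 ++ (List.ofFn fun k : Fin n => t k ++ u k.succ).flatten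

/-- The word that is represented. -/
def word (r : PumpingRep α n) : List α := interleave r.u r.v

/-- The word `w(S, i)`, in which each pumping factor with index in `S` is replaced by its `i`-th
power. -/
def pump (r : PumpingRep α n) (S : Finset (Fin n)) (i : ℕ) : List α :=
  interleave r.u fun k => if k ∈ S then (List.replicate i (r.v k)).flatten else r.v k

/-- `r'`, with word `u'_0 y_1 u'_1 … y_n u'_n`, is a refinement of `r`: there are words `x_k`, `z_k`
with `v_k = x_k y_k z_k` for `1 ≤ k ≤ n` and `u'_k = z_k u_k x_{k+1}` for `0 ≤ k ≤ n`, where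
`z_0` and `x_{n+1}` are empty. Here `x k` stands for `x_{k+1}` and `z k` for `z_k`. -/
def IsRefinement (r' r : PumpingRep α n) : Prop :=
  ∃ x z : Fin (n + 1) → List α,
    z 0 = [] ∧ x (Fin.last n) = [] ∧
    (∀ k : Fin n, r.v k = x k.castSucc ++ r'.v k ++ z k.succ) ∧
    ∀ k : Fin (n + 1), r'.u k = z k ++ r.u k ++ x k

end PumpingRep

/-- `P 0, …, P (m - 1)` is a sequence of non-empty, pairwise disjoint sets with union
everything. -/
def IsIndexPartition {n m : ℕ} (P : Fin m → Finset (Fin n)) : Prop :=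
  (∀ j, (P j).Nonempty) ∧ (∀ j l, j ≠ l → Disjoint (P j) (P l)) ∧ ∀ k, ∃ j, k ∈ P j

/-- `S` contains exactly one element of every `P j`. -/
def IsSelectionSet {n m : ℕ} (P : Fin m → Finset (Fin n)) (S : Finset (Fin n)) : Prop :=
  ∀ j, (S ∩ P j).card = 1

/-! By Ramsey's theorem each long `v_k` contains a factor `y_k` whose reachability relation on
states is idempotent; these factors form the refinement. Two distinct states reaching each other
along an idempotent word would double the number of runs with each repetition, so polynomial
ambiguity forbids them on accepting runs (`PolynomiallyAmbiguous.eq_of_reach`). Hence a run through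
a power of `y_k` with exponent above `|Q|` reads some copy of `y_k` from a state to itself, and this
loop can be cut out. So, for large `i`, `f(w(S,i))` plus the weights of loops chosen for each `k ∈
S` is at most `f(w(S,i+1))` (`PolynomiallyAmbiguous.exists_isConfig`).

A configuration records the states and loops of such a run. If some configuration has only loops of
weight zero over a block `S_j`, going round them bounds `f(w(S_j,i))`, which is eventually
nondecreasing, hence eventually constant. Otherwise every configuration has a loop of positive
weight in every block. With blocks of size at most `K`, a random selection set misses all positive
loops of a given configuration with probability at most `((K-1)/K)^m`. There are only polynomially
many configurations in `n ≤ K m`, so for large `m` one selection set meets a positive loop of each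
of them, and the output strictly increases. -/

/-! ### Sums over state sequences -/

theorem MinPlus.untrop_sum {ι : Type*} [Fintype ι] (f : ι → MinPlus) :
    Tropical.untrop (∑ i, f i) = ⨅ i, Tropical.untrop (f i) := by
  rw [Finset.untrop_sum', Finset.inf_univ_eq_iInf]
  rfl

theorem MinPlus.untrop_eq_top {x : MinPlus} : Tropical.untrop x = ⊤ ↔ x = 0 := by
  rw [← Tropical.untrop_inj_iff, Tropical.untrop_zero]

section PathSum

variable {R Q : Type*} [CommSemiring R] [Fintype Q] [DecidableEq Q]

/-- Stated over any commutative semiring because it is used twice: over `ℕ` it counts runs, over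
min-plus it minimises weights. -/
theorem dotProduct_ofFn_prod_mulVec {n : ℕ} (M : Fin n → Matrix Q Q R) (a b : Q → R) :
    a ⬝ᵥ ((List.ofFn M).prod *ᵥ b) =
      ∑ s : Fin (n + 1) → Q,
        a (s 0) * (∏ k, M k (s k.castSucc) (s k.succ)) * b (s (Fin.last n)) := by
  induction n generalizing a with
  | zero =>
    simp only [List.ofFn_zero, List.prod_nil, one_mulVec, Finset.univ_eq_empty,
      Finset.prod_empty, mul_one, dotProduct]
    exact (Fintype.sum_equiv (Equiv.funUnique (Fin 1) Q) _ _ (fun s => rfl)).symm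
  | succ n ih =>
    rw [List.ofFn_succ, List.prod_cons, ← mulVec_mulVec, dotProduct_mulVec, ih]
    rw [← (Fin.consEquiv fun _ : Fin (n + 2) => Q).sum_comp, Fintype.sum_prod_type,
      Finset.sum_comm]
    refine Finset.sum_congr rfl fun s _ => ?_
    simp only [vecMul, dotProduct, Finset.sum_mul]
    refine Finset.sum_congr rfl fun p _ => ?_
    rw [Fin.prod_univ_succ]
    simp only [Fin.consEquiv_apply, Fin.cons_zero, Fin.cons_succ, Fin.castSucc_zero,
      ← Fin.succ_castSucc, ← Fin.succ_last]
    ring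

end PathSum

/-! ### Path weights, reachability and counting of runs -/

namespace WeightedAutomaton

variable {S α Q : Type*} [CommSemiring S] [Fintype Q] [DecidableEq Q]

theorem wordMatrix_nil (A : WeightedAutomaton S α Q) : A.wordMatrix [] = 1 := rfl

theorem wordMatrix_singleton (A : WeightedAutomaton S α Q) (a : α) :
    A.wordMatrix [a] = A.M a := by
  simp [wordMatrix]

theorem wordMatrix_append (A : WeightedAutomaton S α Q) (x y : List α) :
    A.wordMatrix (x ++ y) = A.wordMatrix x * A.wordMatrix y := by
  simp [wordMatrix]

theorem wordMatrix_flatten (A : WeightedAutomaton S α Q) (L : List (List α)) :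
    A.wordMatrix L.flatten = (L.map A.wordMatrix).prod := by
  induction L with
  | nil => rfl
  | cons x L ih => simp [wordMatrix_append, ih]

theorem output_interleave (A : WeightedAutomaton S α Q) {n : ℕ} (u : Fin (n + 1) → List α)
    (t : Fin n → List α) :
    A.output (PumpingRep.interleave u t) =
      ∑ s : Fin (n + 1) → Q, (A.I ᵥ* A.wordMatrix (u 0)) (s 0) *
        (∏ k, A.wordMatrix (t k ++ u k.succ) (s k.castSucc) (s k.succ)) *
          A.F (s (Fin.last n)) := by
  rw [output, PumpingRep.interleave, wordMatrix_append, wordMatrix_flatten, List.map_ofFn,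
    ← mulVec_mulVec, dotProduct_mulVec, dotProduct_ofFn_prod_mulVec]
  rfl

theorem output_eq_sum (A : WeightedAutomaton S α Q) (w : List α) :
    A.output w = ∑ s : Fin (w.length + 1) → Q, A.I (s 0) *
      (∏ k : Fin w.length, A.M (w.get k) (s k.castSucc) (s k.succ)) *
        A.F (s (Fin.last _)) := by
  have h : w.map A.M = List.ofFn fun k : Fin w.length => A.M (w.get k) := by
    conv_lhs => rw [← List.ofFn_get w, List.map_ofFn]
    rfl
  rw [output, wordMatrix, h, dotProduct_ofFn_prod_mulVec]

open Classical in
/-- The automaton over `ℕ` which has the same transitions as `A`, all of weight one. -/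
noncomputable def counting (A : WeightedAutomaton S α Q) : WeightedAutomaton ℕ α Q where
  M a := Matrix.of fun p q => if A.M a p q = 0 then 0 else 1
  I p := if A.I p = 0 then 0 else 1
  F p := if A.F p = 0 then 0 else 1

/-- Turns ambiguity into matrix products over `ℕ`, where lower bounds follow by dropping nonnegative
terms. -/
theorem output_counting (A : WeightedAutomaton S α Q) (w : List α) :
    A.counting.output w = (A.acceptingRuns w).ncard := by
  classical
  have h0 : ∀ s : Fin (w.length + 1) → Q, A.counting.I (s 0) *
      (∏ k : Fin w.length, A.counting.M (w.get k) (s k.castSucc) (s k.succ)) *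
        A.counting.F (s (Fin.last _)) = if s ∈ A.acceptingRuns w then 1 else 0 := by
    intro s
    by_cases h3 : ∀ i : Fin w.length, A.M (w.get i) (s i.castSucc) (s i.succ) ≠ 0
    · have h : ∏ k : Fin w.length, A.counting.M (w.get k) (s k.castSucc) (s k.succ) = 1 :=
        Finset.prod_eq_one fun i _ => if_neg (h3 i)
      rw [h, mul_one]
      change (if A.I (s 0) = 0 then 0 else 1) * (if A.F (s (Fin.last _)) = 0 then 0 else 1) = _
      by_cases h1 : A.I (s 0) = 0
      · rw [if_pos h1, zero_mul, if_neg fun h => h.1 h1]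
      by_cases h2 : A.F (s (Fin.last _)) = 0
      · rw [if_pos h2, mul_zero, if_neg fun h => h.2.2 h2]
      rw [if_neg h1, if_neg h2, if_pos ⟨h1, h3, h2⟩]
    · rw [if_neg fun h => h3 h.2.1]
      push Not at h3
      obtain ⟨i, hi⟩ := h3
      have h : ∏ k : Fin w.length, A.counting.M (w.get k) (s k.castSucc) (s k.succ) = 0 :=
        Finset.prod_eq_zero (Finset.mem_univ i) (if_pos hi)
      rw [h, mul_zero, zero_mul]
  simp only [output_eq_sum, h0]
  rw [Finset.sum_boole, ← Set.ncard_coe_finset]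
  simp

/-- The least weight of a path from `p` to `q` that reads `w`. -/
def cost (A : WeightedAutomaton MinPlus α Q) (w : List α) (p q : Q) : ℕ∞ :=
  Tropical.untrop (A.wordMatrix w p q)

/-- Some path from `p` to `q` reads `w`. -/
def Reach (A : WeightedAutomaton MinPlus α Q) (w : List α) (p q : Q) : Prop :=
  A.cost w p q ≠ ⊤

/-- Some path from an initial state to `p` reads `w`. -/
def InitReach (A : WeightedAutomaton MinPlus α Q) (w : List α) (p : Q) : Prop :=
  ∃ q, A.I q ≠ 0 ∧ A.Reach w q p

/-- The least weight of a path from an initial state to `p` that reads `w`. -/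
def initCost (A : WeightedAutomaton MinPlus α Q) (w : List α) (p : Q) : ℕ∞ :=
  Tropical.untrop ((A.I ᵥ* A.wordMatrix w) p)

variable (A : WeightedAutomaton MinPlus α Q)

theorem cost_append (x y : List α) (p q : Q) :
    A.cost (x ++ y) p q = ⨅ r, A.cost x p r + A.cost y r q := by
  rw [cost, wordMatrix_append, mul_apply, MinPlus.untrop_sum]
  rfl

theorem initCost_eq_iInf (w : List α) (p : Q) :
    A.initCost w p = ⨅ q, Tropical.untrop (A.I q) + A.cost w q p := by
  rw [initCost, vecMul, dotProduct, MinPlus.untrop_sum]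
  rfl

theorem cost_append_le (x y : List α) (p r q : Q) :
    A.cost (x ++ y) p q ≤ A.cost x p r + A.cost y r q := by
  rw [cost_append]
  exact iInf_le _ r

theorem exists_cost_append (x y : List α) (p q : Q) :
    ∃ r, A.cost (x ++ y) p q = A.cost x p r + A.cost y r q := by
  rw [cost_append]
  have : Nonempty Q := ⟨p⟩
  obtain ⟨r, hr⟩ := exists_eq_ciInf_of_finite (f := fun r => A.cost x p r + A.cost y r q)
  exact ⟨r, hr.symm⟩

theorem cost_nil (p q : Q) : A.cost [] p q = if p = q then 0 else ⊤ := by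
  simp only [cost, wordMatrix_nil, one_apply]
  split_ifs <;> rfl

theorem reach_append {x y : List α} {p q : Q} :
    A.Reach (x ++ y) p q ↔ ∃ r, A.Reach x p r ∧ A.Reach y r q := by
  simp only [Reach, cost_append, ne_eq, iInf_eq_top, ENat.add_eq_top, not_forall, not_or]

theorem reach_nil {p q : Q} : A.Reach [] p q ↔ p = q := by
  rw [Reach, cost_nil]
  split_ifs <;> simp_all

theorem initCost_ne_top {w : List α} {p : Q} : A.initCost w p ≠ ⊤ ↔ A.InitReach w p := by
  simp only [initCost_eq_iInf, InitReach, Reach, ne_eq, iInf_eq_top, ENat.add_eq_top, not_forall,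
    not_or, MinPlus.untrop_eq_top]

theorem initReach_append {x y : List α} {p : Q} :
    A.InitReach (x ++ y) p ↔ ∃ r, A.InitReach x r ∧ A.Reach y r p := by
  simp only [InitReach, reach_append]
  tauto

theorem counting_wordMatrix_ne_zero {w : List α} {p q : Q} :
    A.counting.wordMatrix w p q ≠ 0 ↔ A.Reach w p q := by
  induction w generalizing p with
  | nil => simp [wordMatrix_nil, reach_nil, one_apply]
  | cons a w ih =>
    rw [← List.singleton_append, wordMatrix_append, reach_append, mul_apply]
    simp only [← ih, ne_eq, Finset.sum_eq_zero_iff, Finset.mem_univ, true_imp_iff, not_forall,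
      mul_eq_zero, not_or]
    refine exists_congr fun r => and_congr_left fun _ => ?_
    rw [wordMatrix_singleton, Reach, cost, wordMatrix_singleton, Ne, MinPlus.untrop_eq_top]
    simp [counting]

theorem counting_init_ne_zero {w : List α} {p : Q} :
    (A.counting.I ᵥ* A.counting.wordMatrix w) p ≠ 0 ↔ A.InitReach w p := by
  simp only [vecMul, dotProduct, InitReach, ← counting_wordMatrix_ne_zero, ne_eq,
    Finset.sum_eq_zero_iff, Finset.mem_univ, true_imp_iff, not_forall, mul_eq_zero, not_or]
  simp [counting]

theorem output_interleave_eq_iInf {n : ℕ} (u : Fin (n + 1) → List α) (t : Fin n → List α) :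
    Tropical.untrop (A.output (PumpingRep.interleave u t)) =
      ⨅ s : Fin (n + 1) → Q, (A.initCost (u 0) (s 0) +
        ∑ k, A.cost (t k ++ u k.succ) (s k.castSucc) (s k.succ)) +
          Tropical.untrop (A.F (s (Fin.last n))) := by
  rw [output_interleave, MinPlus.untrop_sum]
  simp only [Tropical.untrop_mul, untrop_prod, initCost, cost]

end WeightedAutomaton

/-! ### Polynomial growth and Ramsey's theorem for triangles -/

theorem Polynomial.eventually_eval_mul_pow_lt (q : Polynomial ℕ) (k : ℕ) :
    ∀ᶠ n : ℕ in atTop, q.eval n * k ^ n < (k + 1) ^ n := by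
  have hk : (0 : ℝ) < k + 1 := by positivity
  have hr : |(k : ℝ) / (k + 1)| < 1 := by
    rw [abs_of_nonneg (by positivity), div_lt_one hk]
    linarith
  have key : Tendsto (fun n : ℕ => ((q.eval n : ℕ) : ℝ) * ((k : ℝ) / (k + 1)) ^ n) atTop
      (nhds 0) := by
    induction q using Polynomial.induction_on' with
    | add p q hp hq =>
      simpa [Polynomial.eval_add, add_mul] using hp.add hq
    | monomial d a =>
      have h := (tendsto_pow_const_mul_const_pow_of_abs_lt_one d hr).const_mul (a : ℝ)
      simpa [Polynomial.eval_monomial, mul_assoc] using h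
  filter_upwards [key.eventually (gt_mem_nhds one_pos)] with n hn
  rw [div_pow, mul_div_assoc', div_lt_one (by positivity)] at hn
  exact_mod_cast hn

theorem Polynomial.eval_mono_nat (q : Polynomial ℕ) : Monotone fun n : ℕ => q.eval n := by
  intro a b h
  simp only [Polynomial.eval_eq_sum, Polynomial.sum]
  exact Finset.sum_le_sum fun i _ => by gcongr

/-- Induction on the number of available colours. Among the neighbours of the least vertex, keep a
large set joined to it by one colour `t`: either an edge of colour `t` inside closes a triangle, or
`t` no longer occurs there. -/
theorem exists_monochromatic_triple_of_card_le (T : Type*) [Finite T] (n : ℕ) :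
    ∃ N : ℕ, ∀ (c : ℕ → ℕ → T) (C : Finset T) (s : Finset ℕ), C.card ≤ n → N ≤ s.card →
      (∀ i ∈ s, ∀ j ∈ s, i < j → c i j ∈ C) →
      ∃ i ∈ s, ∃ j ∈ s, ∃ k ∈ s, i < j ∧ j < k ∧ c i j = c j k ∧ c i j = c i k := by
  classical
  have := Fintype.ofFinite T
  induction n with
  | zero =>
    refine ⟨2, fun c C s hC hs h => ?_⟩
    obtain ⟨a, ha, b, hb, hab⟩ := Finset.one_lt_card.1 hs
    rw [Nat.le_zero, Finset.card_eq_zero] at hC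
    subst hC
    rcases hab.lt_or_gt with hlt | hlt
    · exact absurd (h a ha b hb hlt) (Finset.notMem_empty _)
    · exact absurd (h b hb a ha hlt) (Finset.notMem_empty _)
  | succ n ih =>
    obtain ⟨N, hN⟩ := ih
    refine ⟨Fintype.card T * N + 2, fun c C s hC hs h => ?_⟩
    have hne : s.Nonempty := Finset.card_pos.1 (by omega)
    set i := s.min' hne with hi
    have his : i ∈ s := s.min'_mem hne
    have hlt : ∀ j ∈ s.erase i, i < j := fun j hj => s.min'_lt_of_mem_erase_min' hne hj
    have hcard : (s.erase i).card = s.card - 1 := Finset.card_erase_of_mem his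
    obtain ⟨t, -, ht⟩ := Finset.exists_lt_card_fiber_of_mul_lt_card_of_maps_to
      (s := s.erase i) (t := Finset.univ) (f := c i) (n := N) (fun _ _ => Finset.mem_univ _)
      (by rw [Finset.card_univ]; omega)
    set s' := (s.erase i).filter fun j => c i j = t with hs'
    have hmem : ∀ j ∈ s', j ∈ s ∧ i < j ∧ c i j = t := fun j hj =>
      ⟨Finset.mem_of_mem_erase (Finset.mem_filter.1 hj).1, hlt j (Finset.mem_filter.1 hj).1,
        (Finset.mem_filter.1 hj).2⟩
    by_cases hex : ∃ j ∈ s', ∃ k ∈ s', j < k ∧ c j k = t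
    · obtain ⟨j, hj, k, hk, hjk, hc⟩ := hex
      obtain ⟨hj1, hj2, hj3⟩ := hmem j hj
      obtain ⟨hk1, hk2, hk3⟩ := hmem k hk
      exact ⟨i, his, j, hj1, k, hk1, hj2, hjk, hj3.trans hc.symm, hj3.trans hk3.symm⟩
    · push Not at hex
      obtain ⟨j₀, hj₀⟩ : s'.Nonempty := Finset.card_pos.1 (by omega)
      have htC : t ∈ C := by
        obtain ⟨h1, h2, h3⟩ := hmem j₀ hj₀
        exact h3 ▸ h i his j₀ h1 h2
      obtain ⟨a, ha, b, hb, d, hd, hr⟩ := hN c (C.erase t) s'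
        (by rw [Finset.card_erase_of_mem htC]; omega) ht.le
        (fun j hj k hk hjk => Finset.mem_erase.2
          ⟨hex j hj k hk hjk, h j (hmem j hj).1 k (hmem k hk).1 hjk⟩)
      exact ⟨a, (hmem a ha).1, b, (hmem b hb).1, d, (hmem d hd).1, hr⟩

/-- A finite form of Ramsey's theorem: triangles in complete graphs with coloured edges. -/
theorem exists_monochromatic_triple (T : Type*) [Finite T] :
    ∃ N : ℕ, ∀ c : ℕ → ℕ → T, ∃ i j k, i < j ∧ j < k ∧ k < N ∧ c i j = c j k ∧ c i j = c i k := by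
  classical
  have := Fintype.ofFinite T
  obtain ⟨N, hN⟩ := exists_monochromatic_triple_of_card_le T (Fintype.card T)
  refine ⟨N, fun c => ?_⟩
  obtain ⟨i, -, j, -, k, hk, h1, h2, h3⟩ := hN c Finset.univ (Finset.range N) le_rfl
    (Finset.card_range N).ge (fun _ _ _ _ _ => Finset.mem_univ _)
  exact ⟨i, j, k, h1, h2, Finset.mem_range.1 hk, h3⟩

/-! ### Idempotent words and removal of loops -/

namespace WeightedAutomaton

variable {α Q : Type*} [Fintype Q] [DecidableEq Q] (A : WeightedAutomaton MinPlus α Q)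

/-- The relation of reachability along `y` is idempotent. -/
def IsIdempotentWord (y : List α) : Prop :=
  ∀ p q, A.Reach (y ++ y) p q ↔ A.Reach y p q

/-- Some path from `p` to a final state reads `w`. -/
def CoReach (w : List α) (p : Q) : Prop :=
  ∃ q, A.Reach w p q ∧ A.F q ≠ 0

theorem coReach_append {x y : List α} {p : Q} :
    A.CoReach (x ++ y) p ↔ ∃ r, A.Reach x p r ∧ A.CoReach y r := by
  simp only [CoReach, reach_append]
  tauto

/-- Every long word has a non-empty factor whose reachability relation is idempotent. -/
theorem exists_idempotent_factor : ∃ N : ℕ, ∀ v : List α, N ≤ v.length →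
    ∃ x y z, v = x ++ y ++ z ∧ y ≠ [] ∧ A.IsIdempotentWord y := by
  obtain ⟨N, hN⟩ := exists_monochromatic_triple (Q → Q → Prop)
  refine ⟨N, fun v hv => ?_⟩
  -- Colour a pair of positions by the reachability relation of the factor between them; a triangle
  -- of one colour says that this relation equals its own square.
  obtain ⟨i, j, k, hij, hjk, hk, h1, h2⟩ := hN fun i j => A.Reach ((v.drop i).take (j - i))
  refine ⟨v.take i, (v.drop i).take (j - i), v.drop j, ?_, ?_, fun p q => ?_⟩
  · have h : v.drop j = (v.drop i).drop (j - i) := by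
      rw [List.drop_drop]
      congr 1
      omega
    rw [h, List.append_assoc, List.take_append_drop, List.take_append_drop]
  · intro h
    have := congrArg List.length h
    simp at this
    omega
  · have h : (v.drop i).take (k - i) =
        (v.drop i).take (j - i) ++ (v.drop j).take (k - j) := by
      have h3 : k - i = (j - i) + (k - j) := by omega
      rw [h3, List.take_add, List.drop_drop]
      congr 4
      omega
    rw [h2, h, reach_append, reach_append, ← h1]

theorem counting_mulVec_F_ne_zero {w : List α} {p : Q} :
    (A.counting.wordMatrix w *ᵥ A.counting.F) p ≠ 0 ↔ A.CoReach w p := by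
  simp only [mulVec, dotProduct, CoReach, ← counting_wordMatrix_ne_zero, ne_eq,
    Finset.sum_eq_zero_iff, Finset.mem_univ, true_imp_iff, not_forall, mul_eq_zero, not_or]
  simp [counting]

variable {A}

/-- From either state a copy of `y` can lead to both, so each copy doubles the number of
continuations. -/
theorem two_pow_le_counting {y z : List α} {p q : Q} (hpq : p ≠ q) (hpp : A.Reach y p p)
    (hpq' : A.Reach y p q) (hqp : A.Reach y q p) (hqq : A.Reach y q q)
    (hp : A.CoReach z p) (hq : A.CoReach z q) (n : ℕ) :
    2 ^ n ≤ (A.counting.wordMatrix ((List.replicate n y).flatten ++ z) *ᵥ A.counting.F) p ∧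
    2 ^ n ≤ (A.counting.wordMatrix ((List.replicate n y).flatten ++ z) *ᵥ A.counting.F) q := by
  induction n with
  | zero =>
    simp only [List.replicate_zero, List.flatten_nil, List.nil_append, pow_zero]
    exact ⟨Nat.one_le_iff_ne_zero.2 (A.counting_mulVec_F_ne_zero.2 hp),
      Nat.one_le_iff_ne_zero.2 (A.counting_mulVec_F_ne_zero.2 hq)⟩
  | succ n ih =>
    have key : ∀ r, A.Reach y r p → A.Reach y r q → 2 ^ (n + 1) ≤
        (A.counting.wordMatrix ((List.replicate (n + 1) y).flatten ++ z) *ᵥ A.counting.F) r := by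
      intro r h1 h2
      rw [List.replicate_succ, List.flatten_cons, List.append_assoc, wordMatrix_append,
        ← mulVec_mulVec]
      set g := A.counting.wordMatrix ((List.replicate n y).flatten ++ z) *ᵥ A.counting.F
      rw [mulVec, dotProduct]
      refine le_trans ?_ (Finset.sum_le_univ_sum_of_nonneg (s := {p, q}) fun _ => Nat.zero_le _)
      rw [Finset.sum_pair hpq, pow_succ, mul_two]
      exact add_le_add
        (ih.1.trans (Nat.le_mul_of_pos_left _ (Nat.pos_of_ne_zero
          (A.counting_wordMatrix_ne_zero.2 h1))))
        (ih.2.trans (Nat.le_mul_of_pos_left _ (Nat.pos_of_ne_zero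
          (A.counting_wordMatrix_ne_zero.2 h2))))
    exact ⟨key p hpp hpq', key q hqp hqq⟩

theorem IsIdempotentWord.trans {y : List α} (hy : A.IsIdempotentWord y) {p q r : Q}
    (h : A.Reach y p q) (h' : A.Reach y q r) : A.Reach y p r :=
  (hy p r).1 (A.reach_append.2 ⟨q, h, h'⟩)

/-- In a polynomially ambiguous automaton the strongly connected components of an idempotent word
are trivial, at states that occur in accepting runs. -/
theorem PolynomiallyAmbiguous.eq_of_reach (hA : A.PolynomiallyAmbiguous) {x y z : List α}
    (hy : A.IsIdempotentWord y) {p q : Q} (hx : A.InitReach x p) (hz : A.CoReach z p)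
    (hpq : A.Reach y p q) (hqp : A.Reach y q p) : p = q := by
  by_contra hne
  obtain ⟨P, hP⟩ := hA
  have hpp := hy.trans hpq hqp
  have hqq := hy.trans hqp hpq
  have h := fun n => (two_pow_le_counting hne hpp hpq hqp hqq (A.coReach_append.2 ⟨p, hpp, hz⟩)
    (A.coReach_append.2 ⟨p, hqp, hz⟩) n).1
  -- The word `x yⁿ y z` has length linear in `n` but at least `2 ^ n` accepting runs; the extra `y`
  -- makes both `p` and `q` lead to acceptance.
  obtain ⟨n, hn⟩ := ((P.comp (Polynomial.C y.length * Polynomial.X +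
    Polynomial.C (x.length + y.length + z.length))).eventually_eval_mul_pow_lt 1).exists
  have hout := hP (x ++ ((List.replicate n y).flatten ++ (y ++ z)))
  rw [← output_counting, output, wordMatrix_append, ← mulVec_mulVec, dotProduct_mulVec,
    dotProduct] at hout
  have h1 := Finset.single_le_sum (fun r _ => Nat.zero_le ((A.counting.I ᵥ* A.counting.wordMatrix x)
    r * (A.counting.wordMatrix ((List.replicate n y).flatten ++ (y ++ z)) *ᵥ A.counting.F) r))
    (Finset.mem_univ p)
  have h2 := Nat.le_mul_of_pos_left
    ((A.counting.wordMatrix ((List.replicate n y).flatten ++ (y ++ z)) *ᵥ A.counting.F) p)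
    (Nat.pos_of_ne_zero (A.counting_init_ne_zero.2 hx))
  have h3 := (h n).trans (h2.trans (h1.trans hout))
  have h4 : (x ++ ((List.replicate n y).flatten ++ (y ++ z))).length =
      y.length * n + (x.length + y.length + z.length) := by
    simp
    ring
  rw [h4] at h3
  simp at hn
  omega

theorem IsIdempotentWord.reach_replicate {y : List α} (hy : A.IsIdempotentWord y) (i : ℕ)
    (p q : Q) : A.Reach (List.replicate (i + 1) y).flatten p q ↔ A.Reach y p q := by
  induction i generalizing p with
  | zero => simp
  | succ i ih =>
    rw [List.replicate_succ, List.flatten_cons, reach_append]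
    simp only [ih]
    rw [← reach_append, hy]

theorem IsIdempotentWord.reach_replicate_append {y : List α} (hy : A.IsIdempotentWord y)
    (u : List α) (i : ℕ) (p q : Q) :
    A.Reach ((List.replicate (i + 1) y).flatten ++ u) p q ↔ A.Reach (y ++ u) p q := by
  simp only [reach_append, hy.reach_replicate]

open Classical in
-- Follow an optimal path one copy of `y` at a time. If the first copy stays at `p`, delete it.
-- Otherwise `p` is not reachable from the next state, so the set of states still available shrinks
-- strictly and induction applies.
theorem PolynomiallyAmbiguous.exists_loop_of_card_le (hA : A.PolynomiallyAmbiguous)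
    {y z : List α} (hy : A.IsIdempotentWord y) {q : Q} (hz : A.CoReach z q) (i : ℕ) :
    ∀ (p : Q) (x : List α), A.InitReach x p →
      (Finset.univ.filter fun r => r = p ∨ A.Reach y p r).card ≤ i →
      A.Reach (List.replicate (i + 1) y).flatten p q →
      ∃ r, A.Reach y p r ∧ A.Reach y r r ∧ A.Reach (List.replicate i y).flatten r q ∧
        A.cost (List.replicate i y).flatten p q + A.cost y r r ≤
          A.cost (List.replicate (i + 1) y).flatten p q := by
  induction i with
  | zero =>
    intro p x _ hcard
    rw [Nat.le_zero, Finset.card_eq_zero] at hcard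
    exact absurd (Finset.mem_filter.2 ⟨Finset.mem_univ p, Or.inl rfl⟩)
      (hcard ▸ Finset.notMem_empty p)
  | succ i ih =>
    intro p x hx hcard hpq
    have hrep : ∀ j, (List.replicate (j + 1) y).flatten = y ++ (List.replicate j y).flatten :=
      fun j => by rw [List.replicate_succ, List.flatten_cons]
    rw [hrep (i + 1)] at hpq ⊢
    obtain ⟨s, hs⟩ := A.exists_cost_append y (List.replicate (i + 1) y).flatten p q
    have hps := hpq
    rw [Reach, hs, Ne, ENat.add_eq_top, not_or] at hps
    obtain ⟨hps, hsq⟩ := hps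
    by_cases hsp : s = p
    · subst hsp
      exact ⟨s, hps, hps, hsq, by rw [hs, add_comm]⟩
    have hss : (Finset.univ.filter fun r => r = s ∨ A.Reach y s r) ⊂
        (Finset.univ.filter fun r => r = p ∨ A.Reach y p r) := by
      rw [Finset.ssubset_iff_of_subset]
      · refine ⟨p, by simp, fun h => ?_⟩
        rcases (Finset.mem_filter.1 h).2 with h | h
        · exact hsp h.symm
        · exact hsp (hA.eq_of_reach hy hx (A.coReach_append.2 ⟨q, hpq, hz⟩) hps h).symm
      · intro r hr
        rcases (Finset.mem_filter.1 hr).2 with h | h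
        · exact Finset.mem_filter.2 ⟨Finset.mem_univ r, Or.inr (h ▸ hps)⟩
        · exact Finset.mem_filter.2 ⟨Finset.mem_univ r, Or.inr (hy.trans hps h)⟩
    obtain ⟨r, h1, h2, h3, h4⟩ := ih s (x ++ y) (A.initReach_append.2 ⟨p, hx, hps⟩)
      (by have := Finset.card_lt_card hss; omega) hsq
    refine ⟨r, hy.trans hps h1, h2, ?_, ?_⟩
    · rw [hrep i]
      exact A.reach_append.2 ⟨r, h2, h3⟩
    · rw [hs]
      calc _ ≤ A.cost y p s + A.cost (List.replicate i y).flatten s q + A.cost y r r := by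
            rw [hrep i]
            gcongr
            exact A.cost_append_le _ _ _ _ _
        _ ≤ _ := by
            rw [add_assoc]
            gcongr

/-- From a long power of an idempotent word, a loop can be removed. -/
theorem PolynomiallyAmbiguous.exists_loop (hA : A.PolynomiallyAmbiguous)
    {x y z : List α} (hy : A.IsIdempotentWord y) {p q : Q} (hx : A.InitReach x p)
    (hz : A.CoReach z q) {i : ℕ} (hi : Fintype.card Q ≤ i) (u : List α)
    (hpq : A.Reach ((List.replicate (i + 1) y).flatten ++ u) p q) :
    ∃ r, A.Reach y p r ∧ A.Reach y r r ∧ A.Reach (y ++ u) r q ∧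
      A.cost ((List.replicate i y).flatten ++ u) p q + A.cost y r r ≤
        A.cost ((List.replicate (i + 1) y).flatten ++ u) p q := by
  classical
  obtain ⟨s, hs⟩ := A.exists_cost_append (List.replicate (i + 1) y).flatten u p q
  rw [Reach, hs, Ne, ENat.add_eq_top, not_or] at hpq
  obtain ⟨hps, hsq⟩ := hpq
  obtain ⟨r, h1, h2, h3, h4⟩ := hA.exists_loop_of_card_le hy
    (A.coReach_append.2 ⟨q, hsq, hz⟩) i p x hx ((Finset.card_le_univ _).trans hi) hps
  -- At least one copy of `y` remains, so idempotence reduces the remaining power to a single `y`.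
  have hi0 : i ≠ 0 := by
    have := Fintype.card_pos_iff.2 ⟨p⟩
    omega
  obtain ⟨l, rfl⟩ := Nat.exists_eq_succ_of_ne_zero hi0
  refine ⟨r, h1, h2, A.reach_append.2 ⟨s, (hy.reach_replicate l r s).1 h3, hsq⟩, ?_⟩
  rw [hs]
  calc _ ≤ A.cost (List.replicate (l + 1) y).flatten p s + A.cost u s q + A.cost y r r := by
        gcongr
        exact A.cost_append_le _ _ _ _ _
    _ ≤ _ := by
        rw [add_right_comm]
        gcongr

end WeightedAutomaton

/-! ### Counting selection sets; bounded sequences -/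

/-- Union bound over choice functions: since `Z σ` omits a point of each block, at most a fraction
`(K / (K + 1)) ^ m` of them stay inside `Z σ`. -/
theorem exists_isSelectionSet_not_subset {n m K : ℕ} {P : Fin m → Finset (Fin n)}
    (hP : IsIndexPartition P) (hK : ∀ j, (P j).card ≤ K + 1) {ι : Type*} (C : Finset ι)
    (Z : ι → Finset (Fin n)) (hZ : ∀ σ ∈ C, ∀ j, ¬ P j ⊆ Z σ)
    (hC : C.card * K ^ m < (K + 1) ^ m) :
    ∃ S, IsSelectionSet P S ∧ ∀ σ ∈ C, ¬ S ⊆ Z σ := by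
  classical
  set bad := C.biUnion fun σ => Fintype.piFinset fun j => P j ∩ Z σ with hbad
  have h1 : ∀ σ ∈ C, (K + 1) ^ m * ∏ j, (P j ∩ Z σ).card ≤ K ^ m * ∏ j, (P j).card := by
    intro σ hσ
    have h : ∀ j, (K + 1) * (P j ∩ Z σ).card ≤ K * (P j).card := by
      intro j
      have hlt : (P j ∩ Z σ).card < (P j).card := by
        refine Finset.card_lt_card (Finset.inter_subset_left.ssubset_of_ne fun h => ?_)
        exact hZ σ hσ j (Finset.inter_eq_left.1 h)
      have := hK j
      nlinarith
    simpa [Finset.prod_mul_distrib] using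
      Finset.prod_le_prod (s := Finset.univ) (fun _ _ => Nat.zero_le _) fun j _ => h j
  have h2 : (K + 1) ^ m * bad.card < (K + 1) ^ m * (Fintype.piFinset P).card := by
    calc (K + 1) ^ m * bad.card ≤ (K + 1) ^ m * ∑ σ ∈ C, ∏ j, (P j ∩ Z σ).card := by
          gcongr
          refine Finset.card_biUnion_le.trans_eq ?_
          simp only [Fintype.card_piFinset]
      _ ≤ C.card * (K ^ m * ∏ j, (P j).card) := by
          rw [Finset.mul_sum]
          exact Finset.sum_le_card_nsmul _ _ _ h1
      _ < _ := by
          rw [Fintype.card_piFinset, ← mul_assoc]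
          exact Nat.mul_lt_mul_of_pos_right hC
            (Finset.prod_pos fun j _ => Finset.card_pos.2 (hP.1 j))
  obtain ⟨f, hf, hfb⟩ := Finset.exists_mem_notMem_of_card_lt_card
    (lt_of_mul_lt_mul_left h2 (Nat.zero_le _))
  rw [Fintype.mem_piFinset] at hf
  refine ⟨Finset.univ.image f, fun j => ?_, fun σ hσ hsub => hfb ?_⟩
  · rw [Finset.card_eq_one]
    refine ⟨f j, ?_⟩
    ext k
    simp only [Finset.mem_inter, Finset.mem_image, Finset.mem_univ, true_and,
      Finset.mem_singleton]
    constructor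
    · rintro ⟨⟨l, rfl⟩, hk⟩
      by_contra hne
      have hlj : j ≠ l := fun h => hne (h ▸ rfl)
      exact Finset.disjoint_left.1 (hP.2.1 j l hlj) hk (hf l)
    · rintro rfl
      exact ⟨⟨j, rfl⟩, hf j⟩
  · refine Finset.mem_biUnion.2 ⟨σ, hσ, Fintype.mem_piFinset.2 fun j => ?_⟩
    exact Finset.mem_inter.2 ⟨hf j, hsub (Finset.mem_image_of_mem f (Finset.mem_univ j))⟩

theorem IsIndexPartition.le_mul {n m K : ℕ} {P : Fin m → Finset (Fin n)}
    (hP : IsIndexPartition P) (hK : ∀ j, (P j).card ≤ K) : n ≤ K * m := by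
  classical
  have h : (Finset.univ : Finset (Fin n)) ⊆ Finset.univ.biUnion P := fun k _ => by
    obtain ⟨j, hj⟩ := hP.2.2 k
    exact Finset.mem_biUnion.2 ⟨j, Finset.mem_univ j, hj⟩
  have h2 := (Finset.card_le_card h).trans (Finset.card_biUnion_le_card_mul _ _ K fun j _ => hK j)
  simpa [mul_comm] using h2

/-- The monotone sequence converges to a finite supremum, which is an isolated point of `ℕ∞`. -/
theorem ENat.eventually_eq_succ_of_bounded {g : ℕ → ℕ∞} {i₀ : ℕ} {B : ℕ∞} (hB : B ≠ ⊤)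
    (hg : ∀ i, i₀ ≤ i → g i ≤ g (i + 1)) (hgB : ∀ i, i₀ ≤ i → g i ≤ B) :
    ∀ᶠ i in atTop, g i = g (i + 1) := by
  have hmono : Monotone fun i => g (i + i₀) := monotone_nat_of_le_succ fun i => by
    have := hg (i + i₀) (by omega)
    rwa [show i + i₀ + 1 = i + 1 + i₀ by omega] at this
  have hlim := tendsto_atTop_iSup hmono
  have hL : (⨆ i, g (i + i₀)) ≠ ⊤ :=
    ne_top_of_le_ne_top hB (iSup_le fun i => hgB _ (by omega))
  rw [ENat.nhds_eq_pure hL, tendsto_pure] at hlim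
  have hlim' := (tendsto_add_atTop_nat 1).eventually hlim
  obtain ⟨a, ha⟩ := eventually_atTop.1 (hlim.and hlim')
  refine eventually_atTop.2 ⟨a + i₀, fun i hi => ?_⟩
  obtain ⟨l, rfl⟩ := Nat.exists_eq_add_of_le hi
  obtain ⟨h1, h2⟩ := ha (a + l) (by omega)
  rw [show a + i₀ + l = a + l + i₀ by omega, show a + l + i₀ + 1 = a + l + 1 + i₀ by omega,
    h1, h2]

/-! ### Configurations and pumped outputs -/

namespace WeightedAutomaton

variable {α Q : Type*} [Fintype Q] [DecidableEq Q] (A : WeightedAutomaton MinPlus α Q)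

/-- The states `s` after the factors `u k` of an accepting run over `u 0 y_1 u 1 ⋯ y_n u n`,
together with a loop on each idempotent word `y k` that the run can go through. -/
def IsConfig {n : ℕ} (u : Fin (n + 1) → List α) (y : Fin n → List α)
    (σ : (Fin (n + 1) → Q) × (Fin n → Q)) : Prop :=
  A.InitReach (u 0) (σ.1 0) ∧
    (∀ k, A.Reach (y k) (σ.1 k.castSucc) (σ.2 k) ∧ A.Reach (y k) (σ.2 k) (σ.2 k) ∧
      A.Reach (y k ++ u k.succ) (σ.2 k) (σ.1 k.succ)) ∧
    A.F (σ.1 (Fin.last n)) ≠ 0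

/-- There are finitely many relations on `Q`, so one representative word for each suffices. -/
theorem exists_length_le_reach_eq : ∃ (C : ℕ) (g : List α → List α), ∀ w,
    (g w).length ≤ C ∧ A.Reach (g w) = A.Reach w := by
  obtain ⟨C, hC⟩ := (Set.finite_range fun e => (Function.invFun A.Reach e).length).bddAbove
  exact ⟨C, fun w => Function.invFun A.Reach (A.Reach w), fun w =>
    ⟨hC ⟨_, rfl⟩, Function.invFun_eq ⟨w, rfl⟩⟩⟩

theorem length_interleave_le {n C : ℕ} {u : Fin (n + 1) → List α} {t : Fin n → List α}
    (hu : ∀ k, (u k).length ≤ C) (ht : ∀ k, (t k).length ≤ C) :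
    (PumpingRep.interleave u t).length ≤ 2 * C * n + C := by
  rw [PumpingRep.interleave, List.length_append, List.length_flatten, List.map_ofFn,
    List.sum_ofFn]
  have h : ∑ k : Fin n, (t k ++ u k.succ).length ≤ ∑ _k : Fin n, 2 * C :=
    Finset.sum_le_sum fun k _ => by
      have := hu k.succ
      have := ht k
      simp
      omega
  rw [Finset.sum_const, Finset.card_univ, Fintype.card_fin, smul_eq_mul, mul_comm] at h
  have := hu 0
  simp only [Function.comp_apply]
  omega

variable {A}

/-- Only reachability matters, so all factors may be replaced by representatives of bounded length.
Distinct configurations then contribute distinct runs over a word of length linear in `n`, whatever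
the original lengths. -/
theorem PolynomiallyAmbiguous.exists_card_isConfig_le (hA : A.PolynomiallyAmbiguous) :
    ∃ g : Polynomial ℕ, ∀ (n : ℕ) (u : Fin (n + 1) → List α) (y : Fin n → List α)
      (C : Finset ((Fin (n + 1) → Q) × (Fin n → Q))), (∀ σ ∈ C, A.IsConfig u y σ) →
        C.card ≤ g.eval n := by
  obtain ⟨P, hP⟩ := hA
  obtain ⟨L, g, hg⟩ := A.exists_length_le_reach_eq
  refine ⟨P.comp (Polynomial.C (2 * L) * Polynomial.X + Polynomial.C L), fun n u y C hC => ?_⟩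
  -- The factor `y k` is repeated in `u'`: one copy leads to the loop state, the other leaves it.
  set u' : Fin (n + 1) → List α :=
    Fin.cons (g (u 0)) fun k => g (y k ++ u k.succ) with hu'
  have h1 := hP (PumpingRep.interleave u' fun k => g (y k))
  have hlen : (PumpingRep.interleave u' fun k => g (y k)).length ≤ 2 * L * n + L := by
    refine length_interleave_le (fun k => ?_) fun k => (hg _).1
    refine Fin.cases ?_ (fun k => ?_) k
    · exact (hg _).1
    · exact (hg _).1
  have h2 := h1.trans (P.eval_mono_nat hlen)
  simp only [Polynomial.eval_comp, Polynomial.eval_add, Polynomial.eval_mul, Polynomial.eval_C,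
    Polynomial.eval_X]
  refine le_trans ?_ h2
  rw [← output_counting, output_interleave]
  have h3 : ∀ s : Fin (n + 1) → Q,
      (A.counting.I ᵥ* A.counting.wordMatrix (u' 0)) (s 0) *
        (∏ k : Fin n, A.counting.wordMatrix (g (y k) ++ u' k.succ) (s k.castSucc) (s k.succ)) *
          A.counting.F (s (Fin.last n)) =
      ∑ r : Fin n → Q, (A.counting.I ᵥ* A.counting.wordMatrix (u' 0)) (s 0) *
        (∏ k : Fin n, A.counting.wordMatrix (g (y k)) (s k.castSucc) (r k) *
          A.counting.wordMatrix (u' k.succ) (r k) (s k.succ)) *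
          A.counting.F (s (Fin.last n)) := by
    intro s
    have h := Finset.prod_univ_sum (fun _ : Fin n => (Finset.univ : Finset Q)) fun k q =>
      A.counting.wordMatrix (g (y k)) (s k.castSucc) q *
        A.counting.wordMatrix (u' k.succ) q (s k.succ)
    rw [Fintype.piFinset_univ] at h
    rw [← Finset.sum_mul, ← Finset.mul_sum, ← h]
    simp only [wordMatrix_append, mul_apply]
  rw [Finset.sum_congr rfl fun s _ => h3 s, ← Fintype.sum_prod_type', Finset.card_eq_sum_ones]
  refine le_trans (Finset.sum_le_sum fun σ hσ => ?_)
    (Finset.sum_le_univ_sum_of_nonneg (s := C) fun _ => Nat.zero_le _)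
  obtain ⟨h4, h5, h6⟩ := hC σ hσ
  rw [Nat.one_le_iff_ne_zero]
  refine mul_ne_zero (mul_ne_zero ?_ (Finset.prod_ne_zero_iff.2 fun k _ => mul_ne_zero ?_ ?_)) ?_
  · rw [counting_init_ne_zero, hu', Fin.cons_zero, InitReach, (hg _).2]
    exact h4
  · rw [counting_wordMatrix_ne_zero, (hg _).2]
    exact (h5 k).1
  · rw [counting_wordMatrix_ne_zero, hu', Fin.cons_succ, (hg _).2]
    exact (h5 k).2.2
  · simpa [counting] using h6

variable (A)

/-- The output, as an element of `ℕ∞`, over the word `w(S, i)`. -/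
def pumpOutput {n : ℕ} (r : PumpingRep α n) (S : Finset (Fin n)) (i : ℕ) : ℕ∞ :=
  Tropical.untrop (A.output (r.pump S i))

theorem pumpOutput_le {n : ℕ} (r : PumpingRep α n) (S : Finset (Fin n)) (i : ℕ)
    (s : Fin (n + 1) → Q) :
    A.pumpOutput r S i ≤ (A.initCost (r.u 0) (s 0) +
      ∑ k, A.cost ((if k ∈ S then (List.replicate i (r.v k)).flatten else r.v k) ++ r.u k.succ)
        (s k.castSucc) (s k.succ)) + Tropical.untrop (A.F (s (Fin.last n))) := by
  rw [pumpOutput, PumpingRep.pump, output_interleave_eq_iInf]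
  exact iInf_le _ s

theorem exists_pumpOutput_eq {n : ℕ} (r : PumpingRep α n) (S : Finset (Fin n)) (i : ℕ)
    (h : A.pumpOutput r S i ≠ ⊤) : ∃ s : Fin (n + 1) → Q,
    A.pumpOutput r S i = (A.initCost (r.u 0) (s 0) +
      ∑ k, A.cost ((if k ∈ S then (List.replicate i (r.v k)).flatten else r.v k) ++ r.u k.succ)
        (s k.castSucc) (s k.succ)) + Tropical.untrop (A.F (s (Fin.last n))) := by
  rw [pumpOutput, PumpingRep.pump, output_interleave_eq_iInf] at h ⊢
  rcases isEmpty_or_nonempty (Fin (n + 1) → Q) with he | he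
  · exact absurd (iInf_eq_top.2 fun s => isEmptyElim s) h
  · obtain ⟨s, hs⟩ := exists_eq_ciInf_of_finite (f := fun s : Fin (n + 1) → Q =>
      (A.initCost (r.u 0) (s 0) + ∑ k,
        A.cost ((if k ∈ S then (List.replicate i (r.v k)).flatten else r.v k) ++ r.u k.succ)
          (s k.castSucc) (s k.succ)) + Tropical.untrop (A.F (s (Fin.last n))))
    exact ⟨s, hs.symm⟩

theorem pumpOutput_ne_top {n : ℕ} (r : PumpingRep α n) (S : Finset (Fin n)) (i : ℕ) :
    A.pumpOutput r S i ≠ ⊤ ↔ ∃ s : Fin (n + 1) → Q, A.InitReach (r.u 0) (s 0) ∧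
      (∀ k, A.Reach ((if k ∈ S then (List.replicate i (r.v k)).flatten else r.v k) ++ r.u k.succ)
        (s k.castSucc) (s k.succ)) ∧ A.F (s (Fin.last n)) ≠ 0 := by
  rw [pumpOutput, PumpingRep.pump, output_interleave_eq_iInf]
  simp only [ne_eq, iInf_eq_top, not_forall, ENat.add_eq_top, not_or, ENat.sum_eq_top,
    Finset.mem_univ, true_and, not_exists, MinPlus.untrop_eq_top, and_assoc]
  simp only [← ne_eq, initCost_ne_top, Reach]

variable {A}

theorem pumpOutput_succ_ne_top {n : ℕ} {r : PumpingRep α n}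
    (hr : ∀ k, A.IsIdempotentWord (r.v k)) (S : Finset (Fin n)) (i : ℕ) :
    A.pumpOutput r S (i + 1) ≠ ⊤ ↔ A.pumpOutput r ∅ 0 ≠ ⊤ := by
  rw [pumpOutput_ne_top, pumpOutput_ne_top]
  refine exists_congr fun s => and_congr_right fun _ => and_congr_left fun _ =>
    forall_congr' fun k => ?_
  by_cases hk : k ∈ S
  · simp only [hk, if_true, (hr k).reach_replicate_append, Finset.notMem_empty, if_false]
  · simp only [hk, if_false, Finset.notMem_empty]

/-- Take an optimal run for exponent `i + 1` and cut one loop out of each pumped factor; what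
remains competes for exponent `i`. -/
theorem PolynomiallyAmbiguous.exists_isConfig (hA : A.PolynomiallyAmbiguous) {n : ℕ}
    {r : PumpingRep α n} (hr : ∀ k, A.IsIdempotentWord (r.v k)) (S : Finset (Fin n)) {i : ℕ}
    (hi : Fintype.card Q ≤ i) (h : A.pumpOutput r S (i + 1) ≠ ⊤) :
    ∃ σ, A.IsConfig r.u r.v σ ∧
      A.pumpOutput r S i + ∑ k ∈ S, A.cost (r.v k) (σ.2 k) (σ.2 k) ≤
        A.pumpOutput r S (i + 1) := by
  obtain ⟨s, hs⟩ := A.exists_pumpOutput_eq r S (i + 1) h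
  have h' := h
  rw [hs, Ne, ENat.add_eq_top, ENat.add_eq_top, not_or, not_or] at h'
  obtain ⟨⟨h1, h2⟩, h3⟩ := h'
  rw [← Ne, initCost_ne_top] at h1
  rw [MinPlus.untrop_eq_top] at h3
  replace h2 := fun k => ENat.sum_ne_top.1 h2 k (Finset.mem_univ k)
  have hacc : ∀ k, ∃ x, A.InitReach x (s k) := by
    intro k
    induction k using Fin.induction with
    | zero => exact ⟨_, h1⟩
    | succ k ih =>
      obtain ⟨x, hx⟩ := ih
      exact ⟨_, A.initReach_append.2 ⟨_, hx, h2 k⟩⟩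
  have hco : ∀ k, ∃ z, A.CoReach z (s k) := by
    intro k
    induction k using Fin.reverseInduction with
    | last => exact ⟨[], _, A.reach_nil.2 rfl, h3⟩
    | cast k ih =>
      obtain ⟨z, hz⟩ := ih
      exact ⟨_, A.coReach_append.2 ⟨_, h2 k, hz⟩⟩
  have hloop : ∀ k, ∃ q, (A.Reach (r.v k) (s k.castSucc) q ∧ A.Reach (r.v k) q q ∧
      A.Reach (r.v k ++ r.u k.succ) q (s k.succ)) ∧
      A.cost ((if k ∈ S then (List.replicate i (r.v k)).flatten else r.v k) ++ r.u k.succ)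
        (s k.castSucc) (s k.succ) + (if k ∈ S then A.cost (r.v k) q q else 0) ≤
      A.cost ((if k ∈ S then (List.replicate (i + 1) (r.v k)).flatten else r.v k) ++ r.u k.succ)
        (s k.castSucc) (s k.succ) := by
    intro k
    obtain ⟨x, hx⟩ := hacc k.castSucc
    obtain ⟨z, hz⟩ := hco k.succ
    have h4 := h2 k
    by_cases hk : k ∈ S
    · simp only [hk, if_true] at h4 ⊢
      obtain ⟨q, g1, g2, g3, g4⟩ := hA.exists_loop (hr k) hx hz hi (r.u k.succ) h4
      exact ⟨q, ⟨g1, g2, g3⟩, g4⟩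
    · simp only [hk, if_false] at h4 ⊢
      -- Outside `S` only one copy is read; idempotence allows a high power between the same states,
      -- which yields a loop state.
      obtain ⟨q, g1, g2, g3, -⟩ := hA.exists_loop (hr k) hx hz hi (r.u k.succ)
        (((hr k).reach_replicate_append _ i _ _).2 h4)
      exact ⟨q, ⟨g1, g2, g3⟩, by simp⟩
  choose q hq hcost using hloop
  refine ⟨(s, q), ⟨h1, hq, h3⟩, ?_⟩
  have hsum := Finset.sum_le_sum fun k (_ : k ∈ Finset.univ) => hcost k
  rw [Finset.sum_add_distrib, ← Finset.sum_filter, Finset.filter_mem_eq_inter,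
    Finset.univ_inter] at hsum
  rw [hs]
  refine (add_le_add_left (A.pumpOutput_le r S i s) _).trans ?_
  rw [add_right_comm, add_assoc (A.initCost _ _)]
  exact add_le_add_left (add_le_add_right hsum _) _

theorem cost_replicate_eq_zero {y : List α} {q : Q} (h : A.cost y q q = 0) (i : ℕ) :
    A.cost (List.replicate i y).flatten q q = 0 := by
  induction i with
  | zero => simp [cost_nil]
  | succ i ih =>
    have := A.cost_append_le y (List.replicate i y).flatten q q q
    rw [h, ih, add_zero] at this
    rw [List.replicate_succ, List.flatten_cons]
    exact le_antisymm this zero_le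

/-- One copy of `r.v k` enters the loop state, one leaves it, and the other `i - 2` go round at no
cost. -/
theorem exists_pumpOutput_le {n : ℕ} {r : PumpingRep α n}
    (hr : ∀ k, A.IsIdempotentWord (r.v k)) {S : Finset (Fin n)}
    {σ : (Fin (n + 1) → Q) × (Fin n → Q)} (hσ : A.IsConfig r.u r.v σ)
    (h0 : ∀ k ∈ S, A.cost (r.v k) (σ.2 k) (σ.2 k) = 0) :
    ∃ B : ℕ∞, B ≠ ⊤ ∧ ∀ i, 2 ≤ i → A.pumpOutput r S i ≤ B := by
  obtain ⟨s, q⟩ := σ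
  obtain ⟨h1, h2, h3⟩ := hσ
  refine ⟨(A.initCost (r.u 0) (s 0) + ∑ k, if k ∈ S then
      A.cost (r.v k) (s k.castSucc) (q k) + A.cost (r.v k ++ r.u k.succ) (q k) (s k.succ)
      else A.cost (r.v k ++ r.u k.succ) (s k.castSucc) (s k.succ)) +
      Tropical.untrop (A.F (s (Fin.last n))), ?_, fun i hi => ?_⟩
  · simp only [ne_eq, ENat.add_eq_top, not_or, MinPlus.untrop_eq_top]
    refine ⟨⟨A.initCost_ne_top.2 h1, ENat.sum_ne_top.2 fun k _ => ?_⟩, h3⟩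
    obtain ⟨g1, -, g3⟩ := h2 k
    split_ifs with hk
    · rw [Ne, ENat.add_eq_top, not_or]
      exact ⟨g1, g3⟩
    · have := A.reach_append.2 ⟨_, g1, g3⟩
      rw [← List.append_assoc, reach_append] at this
      obtain ⟨p, g4, g5⟩ := this
      exact A.reach_append.2 ⟨p, (hr k _ _).1 g4, g5⟩
  · refine (A.pumpOutput_le r S i s).trans ?_
    gcongr with k _
    by_cases hk : k ∈ S
    · simp only [hk, if_true]
      obtain ⟨j, rfl⟩ := Nat.exists_eq_add_of_le hi
      have hw : (List.replicate (2 + j) (r.v k)).flatten ++ r.u k.succ =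
          r.v k ++ ((List.replicate j (r.v k)).flatten ++ (r.v k ++ r.u k.succ)) := by
        rw [show 2 + j = (j + 1) + 1 by omega, List.replicate_succ, List.replicate_succ']
        simp
      rw [hw]
      refine (A.cost_append_le _ _ _ (q k) _).trans ?_
      gcongr
      refine (A.cost_append_le _ _ _ (q k) _).trans ?_
      rw [cost_replicate_eq_zero (h0 k hk), zero_add]
    · simp only [hk, if_false, le_refl]

theorem PolynomiallyAmbiguous.pumpOutput_le_succ (hA : A.PolynomiallyAmbiguous) {n : ℕ}
    {r : PumpingRep α n} (hr : ∀ k, A.IsIdempotentWord (r.v k)) (S : Finset (Fin n)) {i : ℕ}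
    (hi : Fintype.card Q ≤ i) : A.pumpOutput r S i ≤ A.pumpOutput r S (i + 1) := by
  by_cases h : A.pumpOutput r S (i + 1) = ⊤
  · rw [h]
    exact le_top
  · obtain ⟨σ, -, hσ⟩ := hA.exists_isConfig hr S hi h
    exact le_self_add.trans hσ

end WeightedAutomaton

theorem mainTheorem3 {α : Type*} [Finite α] (f : List α → ℕ∞)
    (hf : PolyAmbiguouslyRecognisable f) :
    ∃ (N : ℕ) (φ : ℕ → ℕ), ∀ (n : ℕ), 0 < n → ∀ r : PumpingRep α n,
      (∀ k, N ≤ (r.v k).length) →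
      ∃ r' : PumpingRep α n, r'.IsRefinement r ∧
        ∀ (m : ℕ) (P : Fin m → Finset (Fin n)), IsIndexPartition P →
          φ (Finset.univ.sup fun j => (P j).card) ≤ m →
          (∃ j, ∀ᶠ i in atTop, f (r'.pump (P j) i) = f (r'.pump (P j) (i + 1))) ∨
          (∃ S : Finset (Fin n), IsSelectionSet P S ∧
            ∀ᶠ i in atTop, f (r'.pump S i) < f (r'.pump S (i + 1))) := by
  classical
  obtain ⟨Q, _, _, A, hA, hfA⟩ := hf
  obtain ⟨N, hN⟩ := A.exists_idempotent_factor
  obtain ⟨g, hg⟩ := hA.exists_card_isConfig_le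
  have hgrowth : ∀ K : ℕ, ∃ M : ℕ, ∀ m, M ≤ m →
      g.eval ((K + 1) * m) * K ^ m < (K + 1) ^ m := by
    intro K
    -- The polynomial bound is evaluated at `(K + 1) * m`, which bounds `n` when blocks have at most
    -- `K + 1` elements.
    obtain ⟨M, hM⟩ := eventually_atTop.1
      ((g.comp (Polynomial.C (K + 1) * Polynomial.X)).eventually_eval_mul_pow_lt K)
    refine ⟨M, fun m hm => ?_⟩
    simpa only [Polynomial.eval_comp, Polynomial.eval_mul, Polynomial.eval_C,
      Polynomial.eval_X, Nat.cast_id] using hM m hm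
  choose M hM using hgrowth
  refine ⟨N, fun K => M (K - 1), fun n hn r hr => ?_⟩
  choose x y z hxyz hne hid using fun k => hN (r.v k) (hr k)
  let X : Fin (n + 1) → List α := Fin.snoc x []
  let Z : Fin (n + 1) → List α := Fin.cons [] z
  let r' : PumpingRep α n := ⟨fun k => Z k ++ r.u k ++ X k, y, hne⟩
  refine ⟨r', ⟨X, Z, rfl, by simp [X], fun k => by simp [X, Z, r', hxyz k], fun k => rfl⟩,
    fun m P hP hm => ?_⟩
  have hV : ∀ S i, f (r'.pump S i) = A.pumpOutput r' S i := fun S i => hfA _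
  simp only [hV]
  obtain ⟨j₀, hj₀⟩ := hP.2.2 ⟨0, hn⟩
  -- With `∅` nothing is pumped, so this is the output on the refined word itself. If it is
  -- infinite, so is every output with positive exponent.
  by_cases htop : A.pumpOutput r' ∅ 0 = ⊤
  · have h : ∀ i, A.pumpOutput r' (P j₀) (i + 1) = ⊤ := fun i => by
      by_contra h
      exact (WeightedAutomaton.pumpOutput_succ_ne_top hid (P j₀) i).1 h htop
    left
    refine ⟨j₀, eventually_atTop.2 ⟨1, fun i hi => ?_⟩⟩
    obtain ⟨l, rfl⟩ := Nat.exists_eq_add_of_le' hi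
    rw [h, h]
  have hfin : ∀ S i, A.pumpOutput r' S (i + 1) ≠ ⊤ := fun S i =>
    (WeightedAutomaton.pumpOutput_succ_ne_top hid S i).2 htop
  by_cases hconst : ∃ j, ∀ᶠ i in atTop,
      A.pumpOutput r' (P j) i = A.pumpOutput r' (P j) (i + 1)
  · exact Or.inl hconst
  right
  have hpos : ∀ σ, A.IsConfig r'.u r'.v σ → ∀ j,
      ¬ P j ⊆ Finset.univ.filter fun k => A.cost (r'.v k) (σ.2 k) (σ.2 k) = 0 := by
    intro σ hσ j hsub
    obtain ⟨B, hB, hle⟩ := WeightedAutomaton.exists_pumpOutput_le (S := P j) hid hσ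
      fun k hk => (Finset.mem_filter.1 (hsub hk)).2
    refine hconst ⟨j, ENat.eventually_eq_succ_of_bounded
      (g := A.pumpOutput r' (P j)) (i₀ := Fintype.card Q + 2) hB
      (fun i hi => hA.pumpOutput_le_succ hid _ (by omega)) fun i hi => hle i (by omega)⟩
  set K := Finset.univ.sup fun j => (P j).card with hK
  have hPK : ∀ j, (P j).card ≤ K - 1 + 1 := fun j =>
    (Finset.le_sup (f := fun j => (P j).card) (Finset.mem_univ j)).trans (by omega)
  set C := Finset.univ.filter fun σ => A.IsConfig r'.u r'.v σ with hC
  have hcard : C.card * (K - 1) ^ m < (K - 1 + 1) ^ m := by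
    refine lt_of_le_of_lt ?_ (hM (K - 1) m hm)
    gcongr
    exact (hg n r'.u r'.v C fun σ hσ => (Finset.mem_filter.1 hσ).2).trans
      (g.eval_mono_nat (hP.le_mul hPK))
  obtain ⟨S, hS, hSC⟩ := exists_isSelectionSet_not_subset hP hPK C _
    (fun σ hσ => hpos σ (Finset.mem_filter.1 hσ).2) hcard
  -- The extra `1` makes the exponent positive, so the output there is finite and adding a positive
  -- loop weight is a strict increase.
  refine ⟨S, hS, eventually_atTop.2 ⟨Fintype.card Q + 1, fun i hi => ?_⟩⟩
  obtain ⟨l, rfl⟩ := Nat.exists_eq_add_of_le' (show 1 ≤ i by omega)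
  obtain ⟨σ, hσ, hle⟩ := hA.exists_isConfig hid S (by omega) (hfin S (l + 1))
  have hnot := hSC σ (Finset.mem_filter.2 ⟨Finset.mem_univ σ, hσ⟩)
  rw [Finset.not_subset] at hnot
  obtain ⟨k, hkS, hk⟩ := hnot
  have hk0 : A.cost (r'.v k) (σ.2 k) (σ.2 k) ≠ 0 := fun h =>
    hk (Finset.mem_filter.2 ⟨Finset.mem_univ k, h⟩)
  have hsum : (1 : ℕ∞) ≤ ∑ k ∈ S, A.cost (r'.v k) (σ.2 k) (σ.2 k) :=
    (Order.one_le_iff_pos.2 (pos_iff_ne_zero.2 hk0)).trans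
      (Finset.single_le_sum (f := fun k => A.cost (r'.v k) (σ.2 k) (σ.2 k))
        (fun _ _ => zero_le) hkS)
  exact (ENat.add_one_le_iff (hfin S l)).1 ((add_le_add_right hsum _).trans hle)
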